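/- Let $n\ge 0$ and regard $X=SL_n(\mathbb C)$ as a complex manifold (a closed complex submanifold of the space of complex $n\times n$ matrices). A subset of a topological space is called discrete if it is closed and carries the discrete subspace topology. An exhaustion function on $X$ is a continuous function $\rho:X\to[0,\infty)$ such that $\{x\in X:\rho(x)\le r\}$ is compact for every $r\ge 0$. An infinite discrete subset $D\subset X$ is called tame if for every exhaustion function $\rho$ on $X$ and every map $\zeta:D\to[0,\infty)$ there exists a biholomorphic self-map $\phi$ of $X$ such that $\rho(\phi(x))\ge\zeta(x)$ for all $x\in D$. Let $T$ be a torus of $SL_n(\mathbb C)$, i.e. a commutative reductive (not necessarily connected) complex Lie subgroup. Here a complex Lie subgroup is a closed subgroup whose Lie algebra is a complex subspace, and it is reductive if it has finitely many connected components and all its finite-dimensional holomorphic representations are completely reducible. Let $D$ be an infinite discrete subset of $T$. Then $D$ is a tame discrete subset of $SL_n(\mathbb C)$. -/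

import Mathlib

open scoped NNReal

namespace TameSL

/-- The group `SL_n(ℂ)`, with the topology induced from `n × n` complex matrices. -/
abbrev SL (n : ℕ) : Type := Matrix.SpecialLinearGroup (Fin n) ℂ

/-- Let `ι : S → E` be an embedding of `S` into a complex vector space `E`. A map `f : S → F` is
holomorphic if around every point of `S` it is the restriction of a holomorphic map defined on an
open subset of `E`. If `ι` identifies `S` with an embedded complex submanifold of `E = ℂ^N`, this
is exactly holomorphy of `f` as a map of complex manifolds. -/
def HolomorphicAlong {S E F : Type*}
    [AddCommGroup E] [Module ℂ E] [TopologicalSpace E]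
    [AddCommGroup F] [Module ℂ F] [TopologicalSpace F]
    (ι : S → E) (f : S → F) : Prop :=
  ∀ x : S, ∃ U : Set E, IsOpen U ∧ ι x ∈ U ∧
    ∃ G : E → F, DifferentiableOn ℂ G U ∧ ∀ y : S, ι y ∈ U → G (ι y) = f y

/-- The inclusion of `SL_n(ℂ)` into the vector space of `n × n` matrices, of which it is a closed
complex submanifold. -/
def incl (n : ℕ) (g : SL n) : Matrix (Fin n) (Fin n) ℂ := (g : Matrix (Fin n) (Fin n) ℂ)

/-- A self-map of `SL_n(ℂ)` is holomorphic. -/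
def IsHolomorphicSelfMap {n : ℕ} (f : SL n → SL n) : Prop :=
  HolomorphicAlong (incl n) (fun g => incl n (f g))

/-- Automorphisms of the complex manifold `SL_n(ℂ)`: biholomorphic self-maps. They need not be
compatible with the group structure. -/
def IsAutomorphism {n : ℕ} (φ : SL n ≃ SL n) : Prop :=
  IsHolomorphicSelfMap φ ∧ IsHolomorphicSelfMap φ.symm

/-- An exhaustion function: continuous, with compact sublevel sets. -/
def IsExhaustion {X : Type*} [TopologicalSpace X] (ρ : X → ℝ≥0) : Prop :=
  Continuous ρ ∧ ∀ r : ℝ≥0, IsCompact {x : X | ρ x ≤ r}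

/-- Discrete subsets in the sense of complex analysis: closed, with discrete subspace topology
(that is, without accumulation points in the ambient space). -/
def IsDiscreteSubset {X : Type*} [TopologicalSpace X] (D : Set X) : Prop :=
  IsClosed D ∧ IsDiscrete D

/-- (Weakly) tame discrete subsets of the complex manifold `SL_n(ℂ)`. -/
def IsTame {n : ℕ} (D : Set (SL n)) : Prop :=
  D.Infinite ∧ IsDiscreteSubset D ∧
    ∀ ρ : SL n → ℝ≥0, IsExhaustion ρ → ∀ ζ : D → ℝ≥0,
      ∃ φ : SL n ≃ SL n, IsAutomorphism φ ∧ ∀ x : D, ζ x ≤ ρ (φ x)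

/-- The Lie algebra of a closed subgroup `H` of `SL_n(ℂ)`: all matrices `A` with
`exp (tA) ∈ H` for every real `t`. -/
def lieAlg {n : ℕ} (H : Subgroup (SL n)) : Set (Matrix (Fin n) (Fin n) ℂ) :=
  {A | ∀ t : ℝ, ∃ h ∈ H, incl n h = NormedSpace.exp ((t : ℂ) • A)}

/-- Complex Lie subgroups of `SL_n(ℂ)`: closed subgroups whose Lie algebra, which is always a real
subspace, is stable under multiplication by `i`. Equivalently, closed subgroups that are complex
submanifolds. -/
def IsComplexLieSubgroup {n : ℕ} (H : Subgroup (SL n)) : Prop :=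
  IsClosed (H : Set (SL n)) ∧ ∀ A ∈ lieAlg H, Complex.I • A ∈ lieAlg H

/-- A finite-dimensional complex representation of a subgroup of `SL_n(ℂ)` is holomorphic. -/
def IsHolomorphicRep {n m : ℕ} {H : Subgroup (SL n)}
    (ρ : Representation ℂ H (Fin m → ℂ)) : Prop :=
  HolomorphicAlong (fun h : H => incl n (h : SL n)) (fun h : H => LinearMap.toMatrix' (ρ h))

/-- Reductive complex Lie subgroups of `SL_n(ℂ)`: complex Lie subgroups with finitely many
connected components, all of whose finite-dimensional holomorphic representations are completely
reducible. -/
structure IsReductiveSubgroup {n : ℕ} (H : Subgroup (SL n)) : Prop where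
  isComplexLieSubgroup : IsComplexLieSubgroup H
  finite_components : Finite (ConnectedComponents H)
  completely_reducible : ∀ (m : ℕ) (ρ : Representation ℂ H (Fin m → ℂ)),
    IsHolomorphicRep ρ → Representation.IsSemisimpleRepresentation ρ

/-- Tori of `SL_n(ℂ)`: commutative reductive complex Lie subgroups. -/
def IsTorus {n : ℕ} (T : Subgroup (SL n)) : Prop :=
  (∀ a ∈ T, ∀ b ∈ T, a * b = b * a) ∧ IsReductiveSubgroup T

end TameSL

namespace TameSL
open Filter Topology

/-! ### Interpolation by entire functions on locally finite sets. -/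

section Interpolation

variable {E : Type*} [NormedAddCommGroup E] [NormedSpace ℂ E]

/-! The tautological representation of a torus is a semisimple commuting family, so one conjugation
makes `D` diagonal (`IsTorus.exists_conj_diagonal`). Adding `f` times row `j` to row `i` of a
diagonal `g` puts `f * g j j` at position `(i, j)`, so suitable values of `f` push each point as far
as desired. The map is an automorphism if `f` is an entire function of quantities it preserves, here
`shearInvariant`: the diagonal entries of `g` except the `i`-th and those of `g⁻¹` except the
`j`-th.

Such an `f` with prescribed values exists by `exists_entire_interpolation` once the invariants
separate the points and send them to a locally finite set. Separation follows from determinant one.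
Local finiteness can fail when `g j j` tends to `0`, so the points are split by whether `g j j` has
modulus at least or at most `1`; the second half is treated by the opposite shear, with `i` and `j`
exchanged. On diagonal matrices the first shear also preserves the invariants of the second, and
each leaves the entry made large by the other intact (`exists_shears_of_isDiagonal`). Exhaustions
enter only through compactness: on a sublevel set these two entries are bounded. -/

lemma exists_contDiff_vanishing (A : Finset E) {b : E} (hb : b ∉ A) (w : ℂ) :
    ∃ Q : E → ℂ, ContDiff ℂ 1 Q ∧ (∀ a ∈ A, Q a = 0) ∧ Q b = w := by
  classical
  induction A using Finset.induction_on generalizing w with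
  | empty => exact ⟨fun _ => w, contDiff_const, by simp, rfl⟩
  | insert a A _ ih =>
    rw [Finset.mem_insert, not_or] at hb
    obtain ⟨Q, hQ, hQA, hQb⟩ := ih hb.2 w
    have hba : ‖b - a‖ ≠ 0 := norm_ne_zero_iff.2 (sub_ne_zero.2 hb.1)
    -- A functional separating `a` from `b` gives an affine factor equal to `0` at `a` and `1` at
    -- `b`.
    obtain ⟨g, -, hg⟩ := exists_dual_vector ℂ (b - a) hba
    have hg0 : g (b - a) ≠ 0 := by rw [hg]; exact Complex.ofReal_ne_zero.2 hba
    refine ⟨fun z => (g (b - a))⁻¹ * g (z - a) * Q z, ?_, ?_, ?_⟩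
    · exact (contDiff_const.mul (g.contDiff.comp (contDiff_id.sub contDiff_const))).mul hQ
    · intro x hx
      rcases Finset.mem_insert.1 hx with rfl | hx
      · simp
      · simp [hQA x hx]
    · change (g (b - a))⁻¹ * g (b - a) * Q b = w
      rw [inv_mul_cancel₀ hg0, hQb, one_mul]

/-- A function on a complex normed space is entire if it is a series of entire functions which,
together with their derivatives, are eventually dominated by `2⁻ᵏ` on every ball. -/
lemma differentiable_tsum_of_bounds {p : ℕ → E → ℂ} (hp : ∀ k, Differentiable ℂ (p k))
    (hb : ∀ (k : ℕ) z, ‖z‖ ≤ (k : ℝ) - 1 →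
      ‖p k z‖ ≤ (1 / 2 : ℝ) ^ k ∧ ‖fderiv ℂ (p k) z‖ ≤ (1 / 2 : ℝ) ^ k) :
    Differentiable ℂ fun z => ∑' k, p k z := by
  intro x
  -- From index `K` on, the bounds hold on a whole neighbourhood of `x`; the earlier terms form a
  -- finite sum.
  obtain ⟨K, hK⟩ := exists_nat_ge (‖x‖ + 2)
  have hball : ∀ z ∈ Metric.ball (0 : E) (‖x‖ + 1), ∀ k : ℕ, ‖z‖ ≤ ((k + K : ℕ) : ℝ) - 1 := by
    intro z hz k
    rw [mem_ball_zero_iff] at hz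
    push_cast
    have : (0 : ℝ) ≤ k := k.cast_nonneg
    linarith
  have hgeom : Summable fun k : ℕ => (1 / 2 : ℝ) ^ (k + K) :=
    (summable_nat_add_iff K).2 summable_geometric_two
  have hsum : ∀ z ∈ Metric.ball (0 : E) (‖x‖ + 1), Summable fun k => p (k + K) z :=
    fun z hz => Summable.of_norm_bounded hgeom fun k => (hb _ z (hball z hz k)).1
  have hx : x ∈ Metric.ball (0 : E) (‖x‖ + 1) := by simp
  have hpre : IsPreconnected (Metric.ball (0 : E) (‖x‖ + 1)) := by
    let _ : NormedSpace ℝ E := NormedSpace.restrictScalars ℝ ℂ E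
    exact (convex_ball _ _).isPreconnected
  have htail : DifferentiableAt ℂ (fun z => ∑' k, p (k + K) z) x :=
    (hasFDerivAt_tsum_of_isPreconnected hgeom Metric.isOpen_ball hpre
      (fun k z _ => (hp (k + K) z).hasFDerivAt) (fun k z hz => (hb _ z (hball z hz k)).2)
      hx (hsum x hx) hx).differentiableAt
  have hhead : DifferentiableAt ℂ (fun z => ∑ k ∈ Finset.range K, p k z) x :=
    DifferentiableAt.fun_sum fun k _ => hp k x
  refine (hhead.add htail).congr_of_eventuallyEq ?_
  filter_upwards [Metric.isOpen_ball.mem_nhds hx] with z hz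
  exact (((summable_nat_add_iff (f := fun k => p k z) K).1 (hsum z hz)).sum_add_tsum_nat_add K).symm

variable [ProperSpace E]

/-- Multiply a vanishing function `Q` by a high power of a functional `l` with `l b = 1` and `‖l‖ ≤
r / ‖b‖ < 1` on the ball of radius `r`. Geometric decay beats the bounds for `Q` and its derivative,
and the linear factor produced by differentiating the power. -/
lemma exists_peak (A : Finset E) {b : E} (hb : b ∉ A) {r : ℝ} (hr : r < ‖b‖) (w : ℂ)
    {ε : ℝ} (hε : 0 < ε) :
    ∃ P : E → ℂ, Differentiable ℂ P ∧ (∀ a ∈ A, P a = 0) ∧ P b = w ∧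
      ∀ z, ‖z‖ ≤ r → ‖P z‖ ≤ ε ∧ ‖fderiv ℂ P z‖ ≤ ε := by
  obtain ⟨Q, hQ, hQA, hQb⟩ := exists_contDiff_vanishing A hb w
  have hQd : Differentiable ℂ Q := hQ.differentiable one_ne_zero
  rcases lt_or_ge r 0 with hr0 | hr0
  · exact ⟨Q, hQd, hQA, hQb, fun z hz => absurd (norm_nonneg z) (by linarith)⟩
  have hb0 : 0 < ‖b‖ := hr0.trans_lt hr
  obtain ⟨g, hg1, hg⟩ := exists_dual_vector ℂ b hb0.ne'
  obtain ⟨C, hC⟩ := (isCompact_closedBall (0 : E) r).exists_bound_of_continuousOn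
    hQ.continuous.continuousOn
  obtain ⟨C', hC'⟩ := (isCompact_closedBall (0 : E) r).exists_bound_of_continuousOn
    (hQ.continuous_fderiv one_ne_zero).continuousOn
  set l : StrongDual ℂ E := ((‖b‖ : ℂ)⁻¹) • g with hl
  have hlb : l b = 1 := by
    have : (‖b‖ : ℂ) ≠ 0 := by exact_mod_cast hb0.ne'
    simp [hl, hg, this]
  set q := r / ‖b‖ with hq
  have hq0 : 0 ≤ q := by positivity
  have hq1 : q < 1 := (div_lt_one hb0).2 hr
  have hlz : ∀ z : E, ‖z‖ ≤ r → ‖l z‖ ≤ q := by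
    intro z hz
    have := g.le_opNorm z
    rw [hg1, one_mul] at this
    have h2 : ‖l z‖ = ‖g z‖ / ‖b‖ := by simp [hl, div_eq_inv_mul]
    rw [h2, hq]
    gcongr
    exact this.trans hz
  have hlim1 : Tendsto (fun N : ℕ => q ^ (N + 1) * C) atTop (𝓝 0) := by
    simpa using ((tendsto_pow_atTop_nhds_zero_of_lt_one hq0 hq1).comp
      (tendsto_add_atTop_nat 1)).mul_const C
  have hlim2 : Tendsto (fun N : ℕ => q ^ (N + 1) * C' + C * (((N : ℝ) + 1) * q ^ N * ‖l‖))
      atTop (𝓝 0) := by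
    have h1 : Tendsto (fun N : ℕ => q ^ (N + 1) * C') atTop (𝓝 0) := by
      simpa using ((tendsto_pow_atTop_nhds_zero_of_lt_one hq0 hq1).comp
        (tendsto_add_atTop_nat 1)).mul_const C'
    have h2 : Tendsto (fun N : ℕ => ((N : ℝ) + 1) * q ^ N) atTop (𝓝 0) := by
      simpa [add_mul] using (tendsto_self_mul_const_pow_of_lt_one hq0 hq1).add
        (tendsto_pow_atTop_nhds_zero_of_lt_one hq0 hq1)
    simpa using h1.add ((h2.mul_const ‖l‖).const_mul C)
  obtain ⟨N, hN1, hN2⟩ := ((hlim1.eventually_le_const hε).and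
    (hlim2.eventually_le_const hε)).exists
  refine ⟨fun z => l z ^ (N + 1) * Q z, (l.differentiable.pow _).mul hQd, ?_, ?_, ?_⟩
  · intro a ha
    simp [hQA a ha]
  · simp [hlb, hQb]
  intro z hz
  have hz' : z ∈ Metric.closedBall (0 : E) r := by simpa using hz
  have hpow : ∀ k : ℕ, ‖l z ^ k‖ ≤ q ^ k := fun k => by
    rw [norm_pow]; exact pow_le_pow_left₀ (norm_nonneg _) (hlz z hz) k
  have hC0 : 0 ≤ C := (norm_nonneg _).trans (hC z hz')
  constructor
  · refine le_trans ?_ hN1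
    rw [norm_mul]
    exact mul_le_mul (hpow _) (hC z hz') (norm_nonneg _) (by positivity)
  · refine le_trans ?_ hN2
    have hd := (l.hasFDerivAt (x := z)).pow (N + 1) |>.mul (hQd z).hasFDerivAt
    rw [show fderiv ℂ (fun z => l z ^ (N + 1) * Q z) z = _ from hd.fderiv]
    refine (norm_add_le _ _).trans (add_le_add ?_ ?_)
    · rw [norm_smul]
      exact mul_le_mul (hpow _) (hC' z hz') (norm_nonneg _) (by positivity)
    · rw [norm_smul]
      refine mul_le_mul (hC z hz') ?_ (norm_nonneg _) hC0
      rw [norm_smul]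
      refine mul_le_mul_of_nonneg_right ?_ (norm_nonneg _)
      rw [nsmul_eq_mul, norm_mul, Nat.add_sub_cancel]
      refine mul_le_mul ?_ (hpow N) (norm_nonneg _) (by positivity)
      rw [Complex.norm_natCast]; push_cast; rfl

lemma exists_peak_finset (A B : Finset E) (hAB : Disjoint A B) {r : ℝ}
    (hr : ∀ b ∈ B, r < ‖b‖) (w : E → ℂ) {ε : ℝ} (hε : 0 < ε) :
    ∃ P : E → ℂ, Differentiable ℂ P ∧ (∀ a ∈ A, P a = 0) ∧ (∀ b ∈ B, P b = w b) ∧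
      ∀ z, ‖z‖ ≤ r → ‖P z‖ ≤ ε ∧ ‖fderiv ℂ P z‖ ≤ ε := by
  classical
  induction B using Finset.induction_on generalizing A ε with
  | empty =>
    exact ⟨fun _ => 0, differentiable_const _, by simp, by simp, by simp [hε.le]⟩
  | insert b B hbB ih =>
    rw [Finset.disjoint_insert_right] at hAB
    -- `P` is also made to vanish at `b`, and `R` below vanishes on `B`, so neither summand disturbs
    -- the values of the other.
    obtain ⟨P, hP, hPA, hPB, hPs⟩ := ih (insert b A)
      (by rw [Finset.disjoint_insert_left]; exact ⟨hbB, hAB.2⟩)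
      (fun x hx => hr x (Finset.mem_insert_of_mem hx)) (half_pos hε)
    obtain ⟨R, hR, hRA, hRb, hRs⟩ := exists_peak (A ∪ B) (b := b) (by simp [hAB.1, hbB])
      (hr b (Finset.mem_insert_self _ _)) (w b) (half_pos hε)
    refine ⟨P + R, hP.add hR, ?_, ?_, ?_⟩
    · intro a ha
      simp [hPA a (by simp [ha]), hRA a (by simp [ha])]
    · intro x hx
      rcases Finset.mem_insert.1 hx with rfl | hx
      · simp [hPA x (by simp), hRb]
      · simp [hPB x hx, hRA x (by simp [hx])]
    · intro z hz
      have h1 := hPs z hz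
      have h2 := hRs z hz
      rw [fderiv_add (hP z) (hR z)]
      exact ⟨(norm_add_le _ _).trans (by linarith), (norm_add_le _ _).trans (by linarith)⟩

/-- Interpolation by entire functions on a locally finite subset. -/
theorem exists_entire_interpolation (S : Set E)
    (hS : ∀ r : ℝ, (S ∩ Metric.closedBall 0 r).Finite) (w : E → ℂ) :
    ∃ F : E → ℂ, Differentiable ℂ F ∧ ∀ s ∈ S, F s = w s := by
  classical
  -- The radius `k - 1` makes `A 0` empty, so the zero function starts the recursion.
  let A : ℕ → Finset E := fun k => (hS ((k : ℝ) - 1)).toFinset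
  have hA : ∀ k s, s ∈ A k ↔ s ∈ S ∧ ‖s‖ ≤ (k : ℝ) - 1 := fun k s => by simp [A]
  have step : ∀ (k : ℕ) (G : E → ℂ), ∃ P : E → ℂ, Differentiable ℂ P ∧ (∀ a ∈ A k, P a = 0) ∧
      (∀ b ∈ A (k + 1) \ A k, P b = w b - G b) ∧
      ∀ z, ‖z‖ ≤ (k : ℝ) - 1 →
        ‖P z‖ ≤ (1 / 2 : ℝ) ^ k ∧ ‖fderiv ℂ P z‖ ≤ (1 / 2 : ℝ) ^ k := by
    intro k G
    refine exists_peak_finset (A k) (A (k + 1) \ A k) Finset.disjoint_sdiff ?_ (w - G)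
      (by positivity)
    intro b hb
    rw [Finset.mem_sdiff, hA, hA] at hb
    by_contra! h
    exact hb.2 ⟨hb.1.1, h⟩
  choose P hPd hP0 hPw hPb using step
  -- Partial sums: each correction `p k` repairs the error of `G k` on the new points and vanishes
  -- on the old ones, so at a given point the series is eventually zero.
  let G : ℕ → E → ℂ := fun k => Nat.rec (fun _ => 0) (fun k G => G + P k G) k
  let p : ℕ → E → ℂ := fun k => P k (G k)
  have hG : ∀ k z, G k z = ∑ i ∈ Finset.range k, p i z := by
    intro k z
    induction k with
    | zero => rfl
    | succ k ih => rw [Finset.sum_range_succ, ← ih]; rfl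
  have hmono : ∀ {k l : ℕ}, k ≤ l → ∀ s, s ∈ A k → s ∈ A l := by
    intro k l hkl s hs
    rw [hA] at hs ⊢
    have : (k : ℝ) ≤ l := by exact_mod_cast hkl
    exact ⟨hs.1, by linarith [hs.2]⟩
  have hGw : ∀ k, ∀ s ∈ A k, G k s = w s := by
    intro k
    induction k with
    | zero =>
      intro s hs
      have := ((hA 0 s).1 hs).2
      have h0 := norm_nonneg s
      norm_num at this
      linarith
    | succ k ih =>
      intro s hs
      change G k s + P k (G k) s = w s
      by_cases hk : s ∈ A k
      · rw [ih s hk, hP0 k _ s hk, add_zero]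
      · rw [hPw k (G k) s (Finset.mem_sdiff.2 ⟨hs, hk⟩)]; ring
  refine ⟨fun z => ∑' k, p k z, differentiable_tsum_of_bounds (fun k => hPd k _)
    (fun k => hPb k _), fun s hs => ?_⟩
  obtain ⟨k, hk⟩ := exists_nat_ge (‖s‖ + 1)
  have hsk : s ∈ A k := (hA k s).2 ⟨hs, by linarith⟩
  change ∑' k, p k s = w s
  rw [tsum_eq_sum (s := Finset.range k), ← hG, hGw k s hsk]
  intro l hl
  exact hP0 l _ s (hmono (by simpa using hl) s hsk)

end Interpolation

/-! ### Simultaneous diagonalization of tori. -/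

section Diagonalization

variable {G V : Type*} [Monoid G] [AddCommGroup V] [Module ℂ V] [FiniteDimensional ℂ V]
  {ρ : Representation ℂ G V}

/-- The common eigenvectors of a representation. -/
def IsCommonEigenvector (ρ : Representation ℂ G V) (v : V) : Prop :=
  ∀ g, ∃ μ : ℂ, ρ g v = μ • v

/-- Either every operator is scalar on `W`, or some operator has an eigenspace in `W` that is proper
and nonzero; commutativity makes it invariant, and the dimension drops. -/
lemma exists_common_eigenvector (hρ : ∀ g h, Commute (ρ g) (ρ h)) (W : Subrepresentation ρ)
    (hW : W.toSubmodule ≠ ⊥) :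
    ∃ v ∈ W.toSubmodule, v ≠ 0 ∧ IsCommonEigenvector ρ v := by
  induction hd : Module.finrank ℂ W.toSubmodule using Nat.strong_induction_on
    generalizing W with
  | _ d ih =>
  by_cases hs : ∀ g, ∃ μ : ℂ, ∀ v ∈ W.toSubmodule, ρ g v = μ • v
  · obtain ⟨v, hv, hv0⟩ := Submodule.exists_mem_ne_zero_of_ne_bot hW
    exact ⟨v, hv, hv0, fun g => (hs g).imp fun μ h => h v hv⟩
  push Not at hs
  obtain ⟨g, hg⟩ := hs
  have : Nontrivial W.toSubmodule := Submodule.nontrivial_iff_ne_bot.2 hW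
  obtain ⟨μ, hμ⟩ := Module.End.exists_eigenvalue (W.toRepresentation g)
  obtain ⟨x, hx⟩ := hμ.exists_hasEigenvector
  let W' : Subrepresentation ρ :=
    { toSubmodule := W.toSubmodule ⊓ LinearMap.ker (ρ g - μ • LinearMap.id)
      apply_mem_toSubmodule := by
        intro h v hv
        rw [Submodule.mem_inf, LinearMap.mem_ker, LinearMap.sub_apply, sub_eq_zero] at hv ⊢
        refine ⟨W.apply_mem_toSubmodule h hv.1, ?_⟩
        have hc : ρ g (ρ h v) = ρ h (ρ g v) := LinearMap.congr_fun (hρ g h) v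
        rw [hc, hv.2]
        simp }
  have hlt : W'.toSubmodule < W.toSubmodule := by
    refine lt_of_le_of_ne inf_le_left fun heq => ?_
    obtain ⟨v, hv, hne⟩ := hg μ
    rw [← heq] at hv
    have h2 := hv.2
    rw [SetLike.mem_coe, LinearMap.mem_ker, LinearMap.sub_apply, sub_eq_zero] at h2
    exact hne h2
  have hbot : W'.toSubmodule ≠ ⊥ := by
    refine (Submodule.ne_bot_iff _).2 ⟨x, ⟨x.2, ?_⟩, ?_⟩
    · rw [SetLike.mem_coe, LinearMap.mem_ker, LinearMap.sub_apply, sub_eq_zero]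
      exact congrArg Subtype.val hx.apply_eq_smul
    · simpa using hx.2
  obtain ⟨v, hv, h⟩ := ih _ (hd ▸ Submodule.finrank_lt_finrank_of_lt hlt) W' hbot rfl
  exact ⟨v, hv.1, h⟩

/-- An invariant complement of the span, if nonzero, would itself contain a common eigenvector. -/
lemma span_common_eigenvectors_eq_top (hρ : ∀ g h, Commute (ρ g) (ρ h))
    (hs : ρ.IsSemisimpleRepresentation) :
    Submodule.span ℂ {v | IsCommonEigenvector ρ v} = ⊤ := by
  let U : Subrepresentation ρ :=
    { toSubmodule := Submodule.span ℂ {v | IsCommonEigenvector ρ v}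
      apply_mem_toSubmodule := by
        intro g v hv
        induction hv using Submodule.span_induction with
        | mem v hv =>
          obtain ⟨μ, hμ⟩ := hv g
          rw [hμ]
          exact Submodule.smul_mem _ _ (Submodule.subset_span hv)
        | zero => simp
        | add x y _ _ hx hy => rw [map_add]; exact add_mem hx hy
        | smul c x _ hx => rw [map_smul]; exact Submodule.smul_mem _ _ hx }
  obtain ⟨W, hW⟩ := exists_isCompl U
  have hWbot : W.toSubmodule = ⊥ := by
    by_contra hne
    obtain ⟨v, hv, hv0, hev⟩ := exists_common_eigenvector hρ W hne
    have hmem : v ∈ (U ⊓ W).toSubmodule := ⟨Submodule.subset_span hev, hv⟩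
    rw [hW.inf_eq_bot] at hmem
    exact hv0 hmem
  have htop : (U ⊔ W).toSubmodule = ⊤ := by rw [hW.sup_eq_top]; rfl
  rw [Subrepresentation.toSubmodule_sup, hWbot, sup_bot_eq] at htop
  exact htop

/-- The tautological representation of a subgroup of `SL_n(ℂ)`. -/
noncomputable def tautRep {n : ℕ} (T : Subgroup (SL n)) : Representation ℂ T (Fin n → ℂ) where
  toFun t := Matrix.toLin' (incl n t)
  map_one' := Matrix.toLin'_one
  map_mul' s t := Matrix.toLin'_mul (incl n s) (incl n t)

lemma tautRep_apply {n : ℕ} (T : Subgroup (SL n)) (t : T) :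
    tautRep T t = Matrix.toLin' (incl n t) := rfl

/-- Tori in `SL_n(ℂ)` are simultaneously diagonalizable. -/
theorem IsTorus.exists_conj_diagonal {n : ℕ} (i₀ : Fin n) {T : Subgroup (SL n)} (hT : IsTorus T) :
    ∃ P : SL n, ∀ t ∈ T, ∃ d : Fin n → ℂ, incl n (P⁻¹ * t * P) = Matrix.diagonal d := by
  have hhol : IsHolomorphicRep (tautRep T) := fun x =>
    ⟨Set.univ, isOpen_univ, trivial, id, differentiableOn_id, fun y _ =>
      (LinearMap.toMatrix'_toLin' (incl n y)).symm⟩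
  have hcomm : ∀ g h, Commute (tautRep T g) (tautRep T h) := by
    intro g h
    have hgh : g * h = h * g := Subtype.ext (hT.1 g g.2 h h.2)
    rw [commute_iff_eq, ← map_mul, ← map_mul, hgh]
  have hspan := span_common_eigenvectors_eq_top hcomm (hT.2.completely_reducible n _ hhol)
  obtain ⟨f, hf, -, hli⟩ := Submodule.exists_fun_fin_finrank_span_eq ℂ
    {v | IsCommonEigenvector (tautRep T) v}
  have hdim : Module.finrank ℂ (Submodule.span ℂ {v | IsCommonEigenvector (tautRep T) v}) = n := by
    rw [hspan, finrank_top, Module.finrank_fin_fun]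
  let e : Fin n → Fin n → ℂ := f ∘ Fin.cast hdim.symm
  have he : ∀ k, IsCommonEigenvector (tautRep T) (e k) := fun k => hf _
  have heli : LinearIndependent ℂ e := hli.comp _ (Fin.cast_injective _)
  let M : Matrix (Fin n) (Fin n) ℂ := (Matrix.of e).transpose
  have hM : M.det ≠ 0 := by
    rw [Matrix.det_transpose]
    exact ((Matrix.isUnit_iff_isUnit_det _).1
      (Matrix.linearIndependent_rows_iff_isUnit.1 heli)).ne_zero
  -- Rescaling one eigenvector brings the change of basis into `SL n`.
  let c : Fin n → ℂ := Function.update 1 i₀ M.det⁻¹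
  let P : SL n := ⟨M * Matrix.diagonal c, by
    rw [Matrix.det_mul, Matrix.det_diagonal, Finset.prod_update_of_mem (Finset.mem_univ _)]
    simp [hM]⟩
  refine ⟨P, fun t ht => ?_⟩
  choose μ hμ using fun k => he k ⟨t, ht⟩
  refine ⟨μ, ?_⟩
  have hcol : incl n t * M = M * Matrix.diagonal μ := by
    ext a k
    have := congrFun (hμ k) a
    rw [tautRep_apply, Matrix.toLin'_apply] at this
    rw [Matrix.mul_diagonal, mul_comm]
    exact this
  have hP : incl n t * incl n P = incl n P * Matrix.diagonal μ := by
    change incl n t * (M * Matrix.diagonal c) = M * Matrix.diagonal c * Matrix.diagonal μ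
    rw [← mul_assoc, hcol, mul_assoc, mul_assoc, Matrix.diagonal_mul_diagonal,
      Matrix.diagonal_mul_diagonal]
    simp_rw [mul_comm]
  have hmul : ∀ x y : SL n, incl n (x * y) = incl n x * incl n y := fun x y => rfl
  rw [mul_assoc, hmul, hmul, hP, ← mul_assoc, ← hmul, inv_mul_cancel]
  exact one_mul _

end Diagonalization

open Matrix

/-! ### Shears with coefficients depending on invariants. -/

section Shears

variable {n : ℕ}

/-- A self-map of `SL_n(ℂ)` which is the restriction of an entire self-map of the space of
matrices. -/
def HasEntireExtension (f : SL n → SL n) : Prop :=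
  ∃ G : Matrix (Fin n) (Fin n) ℂ → Matrix (Fin n) (Fin n) ℂ,
    Differentiable ℂ (fun M : Fin n → Fin n → ℂ => of.symm (G (of M))) ∧
      ∀ g, G (incl n g) = incl n (f g)

lemma HasEntireExtension.isHolomorphicSelfMap {f : SL n → SL n} (hf : HasEntireExtension f) :
    IsHolomorphicSelfMap f := by
  obtain ⟨G, hG, hGf⟩ := hf
  exact fun x => ⟨Set.univ, isOpen_univ, trivial, G, by exact hG.differentiableOn, fun y _ => hGf y⟩

lemma HasEntireExtension.comp {f g : SL n → SL n} (hf : HasEntireExtension f)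
    (hg : HasEntireExtension g) : HasEntireExtension (f ∘ g) := by
  obtain ⟨F, hF, hFf⟩ := hf
  obtain ⟨G, hG, hGg⟩ := hg
  exact ⟨F ∘ G, hF.comp hG, fun x => by
    rw [Function.comp_apply, hGg, hFf, Function.comp_apply]⟩

lemma incl_mul (g h : SL n) : incl n (g * h) = incl n g * incl n h := rfl

lemma incl_inv (g : SL n) : incl n g⁻¹ = (incl n g).adjugate :=
  Matrix.SpecialLinearGroup.coe_inv g

lemma incl_transvection {i j : Fin n} (hij : i ≠ j) (c : ℂ) :
    incl n (SpecialLinearGroup.transvection hij c) = transvection i j c := rfl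

lemma hasEntireExtension_conj (P : SL n) : HasEntireExtension fun g => P * g * P⁻¹ := by
  refine ⟨fun M => incl n P * M * incl n P⁻¹, ?_, fun g => rfl⟩
  refine differentiable_pi.2 fun a => differentiable_pi.2 fun b => ?_
  simp only [of_symm_apply, Matrix.mul_apply, of_apply]
  fun_prop

/-- The diagonal entries of a matrix `M` and of its adjugate that, on `SL_n(ℂ)`, do not change
when a multiple of row `j` of `M` is added to row `i`. -/
def shearInvariant (i j : Fin n) (M : Matrix (Fin n) (Fin n) ℂ) : (Fin n → ℂ) × (Fin n → ℂ) :=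
  (fun k => if k = i then 0 else M k k, fun k => if k = j then 0 else M.adjugate k k)

lemma differentiable_shearInvariant (i j : Fin n) :
    Differentiable ℂ fun M : Fin n → Fin n → ℂ => shearInvariant i j (of M) := by
  refine Differentiable.prodMk (differentiable_pi.2 fun k => ?_) (differentiable_pi.2 fun k => ?_)
  · split_ifs
    · fun_prop
    · simp only [of_apply]
      fun_prop
  · split_ifs
    · fun_prop
    · simp only [adjugate_apply, det_apply']
      refine Differentiable.fun_sum fun σ _ => (differentiable_const _).mul ?_
      have h : ∀ a, Differentiable ℂ fun M : Fin n → Fin n → ℂ =>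
          (of M).updateRow k (Pi.single k 1) (σ a) a := fun a => by
        simp only [updateRow_apply, of_apply]
        split_ifs <;> fun_prop
      exact fun M => (HasFDerivAt.finsetProd fun a _ => (h a M).hasFDerivAt).differentiableAt

lemma shearInvariant_incl (i j : Fin n) (g : SL n) :
    shearInvariant i j (incl n g) =
      (fun k => if k = i then 0 else incl n g k k, fun k => if k = j then 0 else incl n g⁻¹ k k) := by
  rw [shearInvariant, incl_inv]

lemma transvection_mul_diag {i j : Fin n} (hij : i ≠ j) (c : ℂ) (g : SL n) (k : Fin n)
    (h : k ≠ i ∨ incl n g j i = 0) : incl n (SpecialLinearGroup.transvection hij c * g) k k = incl n g k k := by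
  rw [incl_mul, incl_transvection]
  rcases eq_or_ne k i with rfl | hk
  · rw [transvection_mul_apply_same, h.resolve_left (by simp), mul_zero, add_zero]
  · exact transvection_mul_apply_of_ne _ _ _ _ hk _ _

lemma transvection_mul_inv_diag {i j : Fin n} (hij : i ≠ j) (c : ℂ) (g : SL n) (k : Fin n)
    (h : k ≠ j ∨ incl n g⁻¹ j i = 0) :
    incl n (SpecialLinearGroup.transvection hij c * g)⁻¹ k k = incl n g⁻¹ k k := by
  rw [_root_.mul_inv_rev, SpecialLinearGroup.transvection_inv, incl_mul,
    incl_transvection]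
  rcases eq_or_ne k j with rfl | hk
  · rw [mul_transvection_apply_same, h.resolve_left (by simp), mul_zero, add_zero]
  · exact mul_transvection_apply_of_ne _ _ _ _ hk _ _

/-- The transvection alters only row `i` of `g` and only column `j` of `g⁻¹`, and the invariants
omit exactly those diagonal entries. -/
lemma shearInvariant_transvection_mul {i j : Fin n} (hij : i ≠ j) (c : ℂ) (g : SL n) :
    shearInvariant i j (incl n (SpecialLinearGroup.transvection hij c * g)) =
      shearInvariant i j (incl n g) := by
  rw [shearInvariant_incl, shearInvariant_incl]
  ext k
  · dsimp only
    split_ifs with hk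
    · rfl
    · exact transvection_mul_diag hij c g k (.inl hk)
  · dsimp only
    split_ifs with hk
    · rfl
    · exact transvection_mul_inv_diag hij c g k (.inl hk)

/-- Adding to row `i` the multiple of row `j` by a function of the shear invariants. -/
def shear {i j : Fin n} (hij : i ≠ j) (F : (Fin n → ℂ) × (Fin n → ℂ) → ℂ) : SL n ≃ SL n where
  toFun g := SpecialLinearGroup.transvection hij (F (shearInvariant i j (incl n g))) * g
  invFun g := SpecialLinearGroup.transvection hij (-F (shearInvariant i j (incl n g))) * g
  left_inv g := by
    dsimp only
    rw [shearInvariant_transvection_mul, ← mul_assoc, ← SpecialLinearGroup.transvection_inv,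
      inv_mul_cancel, one_mul]
  right_inv g := by
    dsimp only
    rw [shearInvariant_transvection_mul, ← mul_assoc, ← SpecialLinearGroup.transvection_inv,
      mul_inv_cancel, one_mul]

lemma hasEntireExtension_transvection_mul {i j : Fin n} (hij : i ≠ j)
    {F : (Fin n → ℂ) × (Fin n → ℂ) → ℂ} (hF : Differentiable ℂ F) :
    HasEntireExtension fun g =>
      SpecialLinearGroup.transvection hij (F (shearInvariant i j (incl n g))) * g := by
  refine ⟨fun M => transvection i j (F (shearInvariant i j M)) * M, ?_, fun g => rfl⟩
  have hv := hF.comp (differentiable_shearInvariant i j)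
  refine differentiable_pi.2 fun a => differentiable_pi.2 fun b => ?_
  rcases eq_or_ne a i with rfl | ha
  · simp only [of_symm_apply, transvection_mul_apply_same, of_apply]
    exact (by fun_prop : Differentiable ℂ fun M : Fin n → Fin n → ℂ => M a b).add
      (hv.mul (by fun_prop : Differentiable ℂ fun M : Fin n → Fin n → ℂ => M j b))
  · simp only [of_symm_apply, transvection_mul_apply_of_ne _ _ _ _ ha, of_apply]
    fun_prop

lemma hasEntireExtension_shear {i j : Fin n} (hij : i ≠ j)
    {F : (Fin n → ℂ) × (Fin n → ℂ) → ℂ} (hF : Differentiable ℂ F) :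
    HasEntireExtension (shear hij F) ∧ HasEntireExtension (shear hij F).symm :=
  ⟨hasEntireExtension_transvection_mul hij hF,
    hasEntireExtension_transvection_mul hij (F := fun z => -F z) hF.fun_neg⟩

end Shears

/-! ### Shearing diagonal matrices to infinity. -/

section Diagonal

variable {n : ℕ} {g h : SL n}

/-- Diagonal elements of `SL_n(ℂ)`. -/
def IsDiagonal (g : SL n) : Prop := ∃ d, incl n g = diagonal d

lemma IsDiagonal.apply_ne (hg : IsDiagonal g) {a b : Fin n} (hab : a ≠ b) : incl n g a b = 0 := by
  obtain ⟨d, hd⟩ := hg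
  exact (congrFun (congrFun hd a) b).trans (diagonal_apply_ne d hab)

lemma IsDiagonal.prod_eq_one (hg : IsDiagonal g) : ∏ k, incl n g k k = 1 := by
  obtain ⟨d, hd⟩ := hg
  have h1 : (incl n g).det = 1 := g.2
  rw [hd, det_diagonal] at h1
  exact .trans (Finset.prod_congr rfl fun k _ =>
    (congrFun (congrFun hd k) k).trans (diagonal_apply_eq d k)) h1

lemma IsDiagonal.apply_ne_zero (hg : IsDiagonal g) (k : Fin n) : incl n g k k ≠ 0 :=
  Finset.prod_ne_zero_iff.1 (hg.prod_eq_one.trans_ne one_ne_zero) k (Finset.mem_univ k)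

lemma IsDiagonal.inv_apply_mul (hg : IsDiagonal g) (a b : Fin n) :
    incl n g⁻¹ a b * incl n g b b = (1 : Matrix (Fin n) (Fin n) ℂ) a b := by
  have h1 : incl n (g⁻¹ * g) a b = (1 : Matrix (Fin n) (Fin n) ℂ) a b := by
    rw [inv_mul_cancel]; rfl
  rw [← h1, incl_mul, Matrix.mul_apply, Finset.sum_eq_single b]
  · intro k _ hk
    rw [hg.apply_ne hk, mul_zero]
  · simp

lemma IsDiagonal.inv_apply_ne (hg : IsDiagonal g) {a b : Fin n} (hab : a ≠ b) :
    incl n g⁻¹ a b = 0 := by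
  have := hg.inv_apply_mul a b
  rw [one_apply_ne hab] at this
  exact (mul_eq_zero.1 this).resolve_right (hg.apply_ne_zero b)

lemma IsDiagonal.norm_inv_apply (hg : IsDiagonal g) (k : Fin n) :
    ‖incl n g⁻¹ k k‖ = ‖incl n g k k‖⁻¹ := by
  have := hg.inv_apply_mul k k
  rw [one_apply_eq] at this
  rw [eq_inv_of_mul_eq_one_left this, norm_inv]

lemma IsDiagonal.apply_eq_prod_inv (hg : IsDiagonal g) (i : Fin n) :
    incl n g i i = (∏ k ∈ Finset.univ.erase i, incl n g k k)⁻¹ :=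
  eq_inv_of_mul_eq_one_left <|
    (Finset.mul_prod_erase Finset.univ (fun k => incl n g k k) (Finset.mem_univ i)).trans hg.prod_eq_one

/-- The `(i, i)` entry of `g` changes by a multiple of the `(j, i)` entry, which is zero, and
similarly for the `(j, j)` entry of `g⁻¹`. Hence the second of two opposite shears can be prescribed
at the original points. -/
lemma shearInvariant_transvection_mul_of_isDiagonal {i j : Fin n} (hij : i ≠ j) (c : ℂ)
    (hg : IsDiagonal g) :
    shearInvariant j i (incl n (SpecialLinearGroup.transvection hij c * g)) =
      shearInvariant j i (incl n g) := by
  rw [shearInvariant_incl, shearInvariant_incl]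
  simp only [transvection_mul_diag hij c g _ (.inr (hg.apply_ne hij.symm)),
    transvection_mul_inv_diag hij c g _ (.inr (hg.inv_apply_ne hij.symm))]

lemma IsDiagonal.eq_of_shearInvariant_eq (hg : IsDiagonal g) (hh : IsDiagonal h) {i j : Fin n}
    (heq : shearInvariant i j (incl n g) = shearInvariant i j (incl n h)) : g = h := by
  have hne : ∀ k, k ≠ i → incl n g k k = incl n h k k := fun k hk => by
    have := congrFun (congrArg Prod.fst heq) k
    simpa [shearInvariant, hk] using this
  refine Subtype.ext (Matrix.ext fun a b => ?_)
  change incl n g a b = incl n h a b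
  rcases eq_or_ne a b with rfl | hab
  · rcases eq_or_ne a i with rfl | ha
    · rw [hg.apply_eq_prod_inv, hh.apply_eq_prod_inv]
      exact congrArg _ (Finset.prod_congr rfl fun k hk => hne k (Finset.ne_of_mem_erase hk))
    · exact hne a ha
  · rw [hg.apply_ne hab, hh.apply_ne hab]

lemma norm_apply_le_of_norm_shearInvariant_le {i j k : Fin n} (hk : k ≠ i) {r : ℝ}
    (hr : ‖shearInvariant i j (incl n g)‖ ≤ r) : ‖incl n g k k‖ ≤ r := by
  have h1 := (norm_le_pi_norm _ k).trans ((norm_fst_le _).trans hr)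
  simpa [shearInvariant, hk] using h1

lemma norm_inv_apply_le_of_norm_shearInvariant_le {i j k : Fin n} (hk : k ≠ j) {r : ℝ}
    (hr : ‖shearInvariant i j (incl n g)‖ ≤ r) : ‖incl n g⁻¹ k k‖ ≤ r := by
  rw [shearInvariant_incl] at hr
  have h1 := (norm_le_pi_norm _ k).trans ((norm_snd_le _).trans hr)
  simpa [hk] using h1

lemma IsDiagonal.norm_apply_le_of_bound (hg : IsDiagonal g) {r : ℝ} (hr0 : 0 ≤ r)
    (h : ∀ k, ‖incl n g k k‖ ≤ r) (a b : Fin n) : ‖incl n g a b‖ ≤ r := by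
  rcases eq_or_ne a b with rfl | hab
  · exact h a
  · rwa [hg.apply_ne hab, norm_zero]

/-- Only `g i i` is not controlled directly. It is the product of the inverses of the other `n - 1`
entries: the invariants bound these inverses by `r`, except the `j`-th, which is at most `1` by
assumption. -/
lemma IsDiagonal.norm_apply_le_of_one_le (hg : IsDiagonal g) {i j : Fin n}
    (hj : 1 ≤ ‖incl n g j j‖) {r : ℝ} (hr : ‖shearInvariant i j (incl n g)‖ ≤ r) (a b : Fin n) :
    ‖incl n g a b‖ ≤ max r ((r + 1) ^ (n - 1)) := by
  have hr0 : 0 ≤ r := (norm_nonneg _).trans hr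
  refine hg.norm_apply_le_of_bound (hr0.trans (le_max_left _ _)) (fun k => ?_) a b
  rcases eq_or_ne k i with rfl | hk
  · refine le_trans ?_ (le_max_right _ _)
    rw [hg.apply_eq_prod_inv, norm_inv, norm_prod, ← Finset.prod_inv_distrib]
    refine (Finset.prod_le_prod (g := fun _ => r + 1) (fun _ _ => by positivity)
      fun l _ => ?_).trans_eq (by simp)
    rcases eq_or_ne l j with rfl | hl
    · exact (inv_le_one_of_one_le₀ hj).trans (by linarith)
    · rw [← hg.norm_inv_apply]
      exact (norm_inv_apply_le_of_norm_shearInvariant_le hl hr).trans (by linarith)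
  · exact (norm_apply_le_of_norm_shearInvariant_le hk hr).trans (le_max_left _ _)

lemma IsDiagonal.norm_apply_le_of_le_one (hg : IsDiagonal g) {i j : Fin n}
    (hj : ‖incl n g j j‖ ≤ 1) {r : ℝ} (hr : ‖shearInvariant j i (incl n g)‖ ≤ r) (a b : Fin n) :
    ‖incl n g a b‖ ≤ max r 1 := by
  refine hg.norm_apply_le_of_bound (zero_le_one.trans (le_max_right _ _)) (fun k => ?_) a b
  rcases eq_or_ne k j with rfl | hk
  · exact hj.trans (le_max_right _ _)
  · exact (norm_apply_le_of_norm_shearInvariant_le hk hr).trans (le_max_left _ _)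

lemma exists_entire_shearInvariant_eq (i j : Fin n) {S : Set (SL n)}
    (hdiag : ∀ g ∈ S, IsDiagonal g)
    (hfin : ∀ r : ℝ, {g ∈ S | ‖shearInvariant i j (incl n g)‖ ≤ r}.Finite) (w : SL n → ℂ) :
    ∃ F : (Fin n → ℂ) × (Fin n → ℂ) → ℂ, Differentiable ℂ F ∧
      ∀ g ∈ S, F (shearInvariant i j (incl n g)) = w g := by
  set v : SL n → (Fin n → ℂ) × (Fin n → ℂ) := fun g => shearInvariant i j (incl n g) with hv
  have hinj : Set.InjOn v S := fun g hg h hh heq =>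
    (hdiag g hg).eq_of_shearInvariant_eq (hdiag h hh) heq
  obtain ⟨F, hF, hFw⟩ := exists_entire_interpolation (v '' S) (fun r => by
    refine ((hfin r).image v).subset ?_
    rintro _ ⟨⟨g, hg, rfl⟩, hr⟩
    exact ⟨g, ⟨hg, by simpa using hr⟩, rfl⟩) (fun z => w (Function.invFunOn v S z))
  refine ⟨F, hF, fun g hg => (hFw _ ⟨g, hg, rfl⟩).trans ?_⟩
  rw [hinj.leftInvOn_invFunOn hg]

/-- A locally finite set of diagonal matrices can be moved towards infinity arbitrarily fast by
two successive shears. -/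
theorem exists_shears_of_isDiagonal {i j : Fin n} (hij : i ≠ j) {S : Set (SL n)}
    (hdiag : ∀ g ∈ S, IsDiagonal g)
    (hfin : ∀ r : ℝ, {g ∈ S | ∀ a b, ‖incl n g a b‖ ≤ r}.Finite) (R : SL n → ℝ) :
    ∃ ψ : SL n ≃ SL n, HasEntireExtension ψ ∧ HasEntireExtension ψ.symm ∧
      ∀ g ∈ S, R g ≤ ‖incl n (ψ g) i j‖ ∨ R g ≤ ‖incl n (ψ g) j i‖ := by
  -- The value `R g / g j j` makes the new `(i, j)` entry equal to `R g`; `H` does the same at `(j,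
  -- i)`.
  obtain ⟨F, hF, hFw⟩ := exists_entire_shearInvariant_eq i j (S := {g ∈ S | 1 ≤ ‖incl n g j j‖})
    (fun g hg => hdiag g hg.1)
    (fun r => (hfin _).subset fun g hg =>
      ⟨hg.1.1, (hdiag g hg.1.1).norm_apply_le_of_one_le hg.1.2 hg.2⟩)
    (fun g => R g / incl n g j j)
  obtain ⟨H, hH, hHw⟩ := exists_entire_shearInvariant_eq j i (S := {g ∈ S | ‖incl n g j j‖ ≤ 1})
    (fun g hg => hdiag g hg.1)
    (fun r => (hfin _).subset fun g hg =>
      ⟨hg.1.1, (hdiag g hg.1.1).norm_apply_le_of_le_one hg.1.2 hg.2⟩)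
    (fun g => R g / incl n g i i)
  obtain ⟨h1, h1'⟩ := hasEntireExtension_shear hij hF
  obtain ⟨h2, h2'⟩ := hasEntireExtension_shear hij.symm hH
  refine ⟨(shear hij F).trans (shear hij.symm H), h2.comp h1, h1'.comp h2', fun g hg => ?_⟩
  have hd := hdiag g hg
  set f := F (shearInvariant i j (incl n g)) with hf
  set g₁ := SpecialLinearGroup.transvection hij f * g with hg₁
  have hψ : (shear hij F).trans (shear hij.symm H) g =
      SpecialLinearGroup.transvection hij.symm (H (shearInvariant j i (incl n g))) * g₁ := by
    rw [← shearInvariant_transvection_mul_of_isDiagonal hij f hd]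
    rfl
  rw [hψ, incl_mul, incl_transvection, transvection_mul_apply_of_ne _ _ _ _ hij,
    transvection_mul_apply_same, hg₁, incl_mul, incl_transvection,
    transvection_mul_apply_same, transvection_mul_apply_of_ne _ _ _ _ hij.symm,
    transvection_mul_apply_same, hd.apply_ne hij, hd.apply_ne hij.symm]
  simp only [zero_add, mul_zero, add_zero]
  rcases le_total 1 ‖incl n g j j‖ with hj | hj
  · left
    rw [hf, hFw g ⟨hg, hj⟩, div_mul_cancel₀ _ (hd.apply_ne_zero j), Complex.norm_real]
    exact le_abs_self _
  · right
    rw [hHw g ⟨hg, hj⟩, div_mul_cancel₀ _ (hd.apply_ne_zero i), Complex.norm_real]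
    exact le_abs_self _

end Diagonal

/-! ### From shears to tameness. -/

section Tame

variable {n : ℕ}

lemma isCompact_setOf_norm_apply_le (r : ℝ) : IsCompact {g : SL n | ∀ a b, ‖incl n g a b‖ ≤ r} := by
  have hclosed : Topology.IsClosedEmbedding (Subtype.val : SL n → Matrix (Fin n) (Fin n) ℂ) := by
    refine IsClosed.isClosedEmbedding_subtypeVal ?_
    exact isClosed_eq (continuous_id.matrix_det) continuous_const
  have hK : IsCompact {M : Fin n → Fin n → ℂ | ∀ a b, ‖M a b‖ ≤ r} := by
    have := isCompact_univ_pi fun _ : Fin n => isCompact_univ_pi fun _ : Fin n =>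
      isCompact_closedBall (0 : ℂ) r
    convert this using 1
    ext M
    simp
  exact hclosed.isCompact_preimage hK

lemma continuous_conj_apply (P : SL n) (a b : Fin n) :
    Continuous fun g : SL n => incl n (P⁻¹ * g * P) a b := by
  have h1 : Continuous fun g : SL n => P⁻¹ * g * P :=
    (continuous_const.mul continuous_id).mul continuous_const
  exact Continuous.matrix_elem (A := fun g => incl n (P⁻¹ * g * P))
    (continuous_subtype_val.comp h1) a b

/-- Infinite discrete sets of simultaneously diagonalizable elements are tame. -/
theorem isTame_of_conj_diagonal {D : Set (SL n)} (hinf : D.Infinite) (hD : IsDiscreteSubset D)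
    (P : SL n) (hP : ∀ g ∈ D, IsDiagonal (P⁻¹ * g * P)) : IsTame D := by
  -- For `n ≤ 1` the group is a single point and has no infinite subset.
  have hn : Nontrivial (Fin n) := by
    by_contra hn
    rw [not_nontrivial_iff_subsingleton] at hn
    refine hinf (Set.Subsingleton.finite ?_)
    intro x _ y _
    refine Subtype.ext (Matrix.ext fun a b => ?_)
    have hdet : ∀ z : SL n, incl n z a b = 1 := fun z => by
      rw [Subsingleton.elim b a]
      exact (det_eq_elem_of_subsingleton _ a).symm.trans z.2
    exact (hdet x).trans (hdet y).symm
  obtain ⟨i, j, hij⟩ := exists_pair_ne (Fin n)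
  refine ⟨hinf, hD, fun ρ hρ ζ => ?_⟩
  -- The sublevel set of `ρ` at height `ζ x` is compact, so an `(i, j)` or `(j, i)` entry of size at
  -- least `C x` in conjugated coordinates forces `ρ` above `ζ x`.
  have hbound : ∀ x : SL n, ∃ C : ℝ, ∀ hx : x ∈ D, ∀ g, ρ g ≤ ζ ⟨x, hx⟩ →
      ‖incl n (P⁻¹ * g * P) i j‖ < C ∧ ‖incl n (P⁻¹ * g * P) j i‖ < C := by
    intro x
    by_cases hx : x ∈ D
    · obtain ⟨C₁, h₁⟩ := (hρ.2 (ζ ⟨x, hx⟩)).exists_bound_of_continuousOn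
        (continuous_conj_apply P i j).continuousOn
      obtain ⟨C₂, h₂⟩ := (hρ.2 (ζ ⟨x, hx⟩)).exists_bound_of_continuousOn
        (continuous_conj_apply P j i).continuousOn
      exact ⟨max C₁ C₂ + 1, fun _ g hg =>
        ⟨by linarith [h₁ g hg, le_max_left C₁ C₂], by linarith [h₂ g hg, le_max_right C₁ C₂]⟩⟩
    · exact ⟨0, fun h => absurd h hx⟩
  choose C hC using hbound
  have hconj : ∀ g : SL n, P * (P⁻¹ * g * P) * P⁻¹ = g := fun g => by group
  have hconj' : ∀ g : SL n, P⁻¹ * (P * g * P⁻¹) * P = g := fun g => by group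
  let κ : SL n ≃ SL n :=
    { toFun := fun g => P⁻¹ * g * P
      invFun := fun g => P * g * P⁻¹
      left_inv := hconj
      right_inv := hconj' }
  have hκ : HasEntireExtension κ := by
    have := hasEntireExtension_conj P⁻¹
    rwa [inv_inv] at this
  have hκ' : HasEntireExtension κ.symm := hasEntireExtension_conj P
  obtain ⟨ψ, hψ, hψ', hψR⟩ := exists_shears_of_isDiagonal hij (S := κ '' D)
    (by rintro _ ⟨g, hg, rfl⟩; exact hP g hg)
    (fun r => by
      have hcont : Continuous κ.symm :=
        (continuous_const.mul continuous_id).mul continuous_const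
      have hK := ((isCompact_setOf_norm_apply_le r).image hcont).inter_right hD.1
      refine ((hK.finite (hD.2.mono Set.inter_subset_right)).image κ).subset ?_
      rintro _ ⟨⟨g, hg, rfl⟩, hr⟩
      exact ⟨g, ⟨⟨κ g, hr, κ.symm_apply_apply g⟩, hg⟩, rfl⟩)
    (fun g => C (κ.symm g))
  refine ⟨(κ.trans ψ).trans κ.symm, ⟨(hκ'.comp (hψ.comp hκ)).isHolomorphicSelfMap,
    (hκ'.comp (hψ'.comp hκ)).isHolomorphicSelfMap⟩, fun x => ?_⟩
  by_contra! hlt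
  obtain ⟨h1, h2⟩ := hC x x.2 _ hlt.le
  have heq : P⁻¹ * ((κ.trans ψ).trans κ.symm) x * P = ψ (κ x) := hconj' _
  rw [heq] at h1 h2
  have h3 := hψR (κ x) ⟨x, x.2, rfl⟩
  rw [κ.symm_apply_apply] at h3
  rcases h3 with h3 | h3
  · exact absurd h1 h3.not_gt
  · exact absurd h2 h3.not_gt

end Tame

end TameSL

theorem mainTheorem8 (n : ℕ) (T : Subgroup (TameSL.SL n)) (hT : TameSL.IsTorus T)
    (D : Set T) (hD : TameSL.IsDiscreteSubset D) (hinf : D.Infinite) :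
    TameSL.IsTame ((fun t : T => (t : TameSL.SL n)) '' D) := by
  have hemb : Topology.IsClosedEmbedding (fun t : T => (t : TameSL.SL n)) :=
    IsClosed.isClosedEmbedding_subtypeVal hT.2.isComplexLieSubgroup.1
  have hinf' := hinf.image (f := fun t : T => (t : TameSL.SL n)) Subtype.val_injective.injOn
  have hdisc : TameSL.IsDiscreteSubset ((fun t : T => (t : TameSL.SL n)) '' D) :=
    ⟨hemb.isClosedMap _ hD.1, hD.2.image hemb.isInducing⟩
  obtain ⟨P, hP⟩ : ∃ P : TameSL.SL n, ∀ t ∈ T, TameSL.IsDiagonal (P⁻¹ * t * P) := by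
    -- Diagonalization needs an index at which to rescale, so `n = 0` is separate.
    rcases isEmpty_or_nonempty (Fin n) with h | ⟨⟨i⟩⟩
    · exact ⟨1, fun t _ => ⟨0, Subsingleton.elim _ _⟩⟩
    · exact hT.exists_conj_diagonal i
  refine TameSL.isTame_of_conj_diagonal hinf' hdisc P ?_
  rintro _ ⟨t, _, rfl⟩
  exact hP t t.2
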